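/- **Setting.** Let $X\in\mathbb R^{n\times p}$ be a fixed design matrix and $y=X\beta^*+\xi$, where $\xi_1,\dots,\xi_n$ are i.i.d. zero-mean sub-Gaussian random variables with parameter $\sigma>0$ (that is, $\mathbb E e^{\lambda\xi_i}\le e^{\lambda^2\sigma^2/2}$ for all $\lambda\in\mathbb R$), and $S^*=\{j:\beta^*_j\ne0\}$ has size $s$. Suppose that: 1. there are $b_x,b_y>0$ with $|X_{ij}|\le b_x$ and, almost surely, $|y_i|\le b_y$ for all $i,j$; 2. there is $M>0$ with $\|\beta^*\|_2\le M$; 3. (sparse Riesz condition) there are $\kappa_-,\kappa_+>0$ with $\kappa_-\le\lambda_{\min}(X_S^\top X_S/n)\le\lambda_{\max}(X_S^\top X_S/n)\le\kappa_+$ for all $S\subseteq[p]$ with $|S|=s$; 4. $s\le n/\log p$ and $p\ge3$. With $\hat\Sigma=X^\top X/n$, let $\hat D(S)=\hat\Sigma_{S^*\setminus S,S^*\setminus S}-\hat\Sigma_{S^*\setminus S,S}\hat\Sigma_{S,S}^{-1}\hat\Sigma_{S,S^*\setminus S}$ and define the identifiability margin $$\tau=\min\Big\{\frac{\beta_{S^*\setminus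 S}^{*\top}\hat D(S)\beta^*_{S^*\setminus S}}{|S^*\setminus S|}:\ S\subseteq[p],\ |S|=s,\ 1\le|S\setminus S^*|\le s\Big\}.$$ **Top-$R$ method.** Let $\varepsilon>0$, $r\ge\frac{\kappa_+}{\kappa_-}M+\frac{4\sigma b_x}{\kappa_-}$, $\Delta=2b_y^2+2b_x^2r^2s$, let $R$ be an integer with $1<R\le\binom ps$, and let $T\in\{1,2,\dots\}\cup\{\infty\}$. For a dataset $\mathcal D=(X,y)$ put $\mathcal R(S,\mathcal D)=\min_{b\in\mathbb R^{S},\,\|b\|_2\le r}\|y-X_Sb\|_2^2$, and let $\hat S_1(\mathcal D),\dots,\hat S_R(\mathcal D)$ be such that $\hat S_k(\mathcal D)$ minimizes $\mathcal R(\cdot,\mathcal D)$ among the supports of size $s$ different from $\hat S_1(\mathcal D),\dots,\hat S_{k-1}(\mathcal D)$ (ties broken arbitrarily). The method $\hat{\mathcal M}$ first clips the entries of $X$ and $y$ to $[-b_x,b_x]$ and $[-b_y,b_y]$, and then draws $a\in\{1,\dots,R+1\}$ with $$\mathbb P(a=k)\propto e^{-\varepsilon\mathcal R(\hat S_k(\mathcal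 D),\mathcal D)/(2\Delta)}\ (k\le R),\qquad \mathbb P(a=R+1)\propto\Big(\tbinom ps-R\Big)e^{-\varepsilon\mathcal R(\hat S_R(\mathcal D),\mathcal D)/(2\Delta)}.$$ If $a\le R$ it returns $\hat S_a(\mathcal D)$. If $a=R+1$ it draws supports of size $s$ independently and uniformly, until one is outside $\{\hat S_1(\mathcal D),\dots,\hat S_R(\mathcal D)\}$ or $T$ draws have been made, and returns the last one drawn (for $T=\infty$: a uniform support of size $s$ outside $\{\hat S_1(\mathcal D),\dots,\hat S_R(\mathcal D)\}$). **Claim.** There is a universal constant $C>0$ such that, in every such setting, whenever $$\tau\ \ge\ \max\Big\{C\sigma^2,\ \frac{8\Delta}{\varepsilon}s\Big\}\frac{\log p}{n},$$ we have $$\mathbb P\big(\hat{\mathcal M}(\mathcal D)=S^*\big)\ \ge\ \frac{1-10sp^{-2}}{1+p^{-s}},$$ where the probability is over both the noise $\xi$ and the randomness of the method. -/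

import Mathlib

open MeasureTheory ProbabilityTheory
open scoped ENNReal NNReal

namespace TopR

noncomputable section

/-- A dataset `(X, y)` with `n` observations of `p` features. -/
abbrev Dataset (n p : ℕ) : Type := Matrix (Fin n) (Fin p) ℝ × (Fin n → ℝ)

/-- The outcome set: all subsets of the `p` features that have size `s`. -/
def supports (p s : ℕ) : Finset (Finset (Fin p)) := Finset.powersetCard s Finset.univ

/-- Residual sum of squares of the coefficients `b`, which live on the features in `S`. -/
def rss {n p : ℕ} (D : Dataset n p) (S : Finset (Fin p)) (b : EuclideanSpace ℝ S) : ℝ :=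
  ∑ i, (D.2 i - ∑ j : S, D.1 i j * b j) ^ 2

/-- The score `min ‖y - X_S b‖₂²` subject to `‖b‖₂² ≤ r²` (the minimum is attained, since the
constraint set is compact and contains `0`). -/
def score {n p : ℕ} (r : ℝ) (D : Dataset n p) (S : Finset (Fin p)) : ℝ :=
  sInf (rss D S '' {b | ‖b‖ ^ 2 ≤ r ^ 2})

/-- `Shat 0, Shat 1, …, Shat (R - 1)` are successive best supports of size `s` for the objective
`f`: each one minimizes `f` among the supports that differ from all the previous ones.
Ties may be broken in any way. -/
def IsBestSupports {p R : ℕ} (s : ℕ) (f : Finset (Fin p) → ℝ)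
    (Shat : Fin R → Finset (Fin p)) : Prop :=
  ∀ k : Fin R, (Shat k ∈ supports p s ∧ ∀ i < k, Shat k ≠ Shat i) ∧
    ∀ S ∈ supports p s, (∀ i < k, S ≠ Shat i) → f (Shat k) ≤ f S

/-- Clip a real number to `[-c, c]`. -/
def clip (c a : ℝ) : ℝ := max (-c) (min c a)

/-- Clip the features to `[-bX, bX]` and the responses to `[-bY, bY]`, entry by entry. -/
def clipData {n p : ℕ} (bX bY : ℝ) (D : Dataset n p) : Dataset n p :=
  (fun i j => clip bX (D.1 i j), fun i => clip bY (D.2 i))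

/-- The sensitivity bound `Δ = 2 b_y² + 2 b_x² r² s`. -/
def sensitivity (bX bY r : ℝ) (s : ℕ) : ℝ := 2 * bY ^ 2 + 2 * bX ^ 2 * r ^ 2 * s

theorem supports_nonempty {p s R : ℕ} (hR : 1 < R) (hRN : R ≤ p.choose s) :
    (supports p s).Nonempty := by
  rw [← Finset.card_pos, supports, Finset.card_powersetCard, Finset.card_univ, Fintype.card_fin]
  omega

/-- Unnormalized masses of the first draw. The outcome `some k` selects the support `k` among the
`R` enumerated ones, whose objective values are `v`; the outcome `none` (number `R + 1`) stands
for all the `choose p s - R` other supports together, at the objective value of the last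
enumerated one. -/
def firstWeight {R : ℕ} (p s : ℕ) (hR : 1 < R) (eps Δ : ℝ) (v : Fin R → ℝ) :
    Option (Fin R) → ℝ≥0∞
  | some k => ENNReal.ofReal (Real.exp (-(eps * v k) / (2 * Δ)))
  | none => ENNReal.ofReal
      (((p.choose s : ℝ) - R) * Real.exp (-(eps * v ⟨R - 1, by omega⟩) / (2 * Δ)))

theorem tsum_firstWeight_ne_zero {R : ℕ} (p s : ℕ) (hR : 1 < R) (eps Δ : ℝ) (v : Fin R → ℝ) :
    ∑' a, firstWeight p s hR eps Δ v a ≠ 0 := by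
  intro h
  have h0 := ENNReal.tsum_eq_zero.1 h (some ⟨0, by omega⟩)
  have h1 := Real.exp_pos (-(eps * v ⟨0, by omega⟩) / (2 * Δ))
  simp only [firstWeight, ENNReal.ofReal_eq_zero] at h0
  linarith

theorem tsum_firstWeight_ne_top {R : ℕ} (p s : ℕ) (hR : 1 < R) (eps Δ : ℝ) (v : Fin R → ℝ) :
    ∑' a, firstWeight p s hR eps Δ v a ≠ ⊤ := by
  rw [tsum_fintype]
  refine ENNReal.sum_ne_top.2 fun a _ => ?_
  cases a <;> simp [firstWeight]

/-- The distribution of the first draw. -/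
def firstDraw {R : ℕ} (p s : ℕ) (hR : 1 < R) (eps Δ : ℝ) (v : Fin R → ℝ) :
    PMF (Option (Fin R)) :=
  PMF.normalize (firstWeight p s hR eps Δ v) (tsum_firstWeight_ne_zero p s hR eps Δ v)
    (tsum_firstWeight_ne_top p s hR eps Δ v)

/-- Rejection sampling with at most `T ≥ 1` independent draws from `U`: stop at the first draw
that lies in `A`, and return the last draw that was made. (No meaning is attached to `T = 0`.) -/
def boundedRejection {α : Type} [DecidableEq α] (U : PMF α) (A : Finset α) : ℕ → PMF α
  | 0 => U
  | 1 => U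
  | T + 2 => U.bind fun x => if x ∈ A then PMF.pure x else boundedRejection U A (T + 1)

/-- Uniform draws from the nonempty set `O`, at most `T` of them, until one lies in `A ⊆ O`.
For `T = ∞` the first accepted draw is uniform on `A`; if `A` is empty the unlimited procedure
never stops, and the value is then a convention without effect. -/
def rejection {α : Type} [DecidableEq α] (O : Finset α) (hO : O.Nonempty) (A : Finset α) :
    ℕ∞ → PMF α
  | (T : ℕ) => boundedRejection (PMF.uniformOfFinset O hO) A T
  | ⊤ => if hA : A.Nonempty then PMF.uniformOfFinset A hA else PMF.uniformOfFinset O hO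

/-- The output distribution of the top-`R` method on the dataset `D`, with privacy parameter
`eps`, at most `T` draws in the rejection step, and an oracle `Shat` that returns `R` successive
best supports of a dataset. -/
def topR {n p R : ℕ} (s : ℕ) (hR : 1 < R) (hRN : R ≤ p.choose s) (bX bY r eps : ℝ) (T : ℕ∞)
    (Shat : Dataset n p → Fin R → Finset (Fin p)) (D : Dataset n p) : PMF (Finset (Fin p)) :=
  let D' := clipData bX bY D
  (firstDraw p s hR eps (sensitivity bX bY r s) fun k => score r D' (Shat D' k)).bind fun a =>
    match a with
    | some k => PMF.pure (Shat D' k)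
    | none => rejection (supports p s) (supports_nonempty hR hRN)
        (supports p s \ Finset.univ.image (Shat D')) T

/-- The sample covariance `XᵀX / n`. -/
def sampleCov {n p : ℕ} (X : Matrix (Fin n) (Fin p) ℝ) : Matrix (Fin p) (Fin p) ℝ :=
  (n : ℝ)⁻¹ • (X.transpose * X)

/-- The block of a matrix with rows in `S₁` and columns in `S₂`. -/
def block {p : ℕ} (A : Matrix (Fin p) (Fin p) ℝ) (S₁ S₂ : Finset (Fin p)) : Matrix S₁ S₂ ℝ :=
  A.submatrix Subtype.val Subtype.val

/-- Sparse Riesz condition: for every `S` of size `s`, all the eigenvalues of `X_Sᵀ X_S / n` lie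
in `[κlo, κhi]`. -/
def SparseRiesz {n p : ℕ} (X : Matrix (Fin n) (Fin p) ℝ) (s : ℕ) (κlo κhi : ℝ) : Prop :=
  ∀ S ∈ supports p s, spectrum ℝ (block (sampleCov X) S S) ⊆ Set.Icc κlo κhi

/-- The support `S* = {j | β*_j ≠ 0}`. -/
def trueSupport {p : ℕ} (β : EuclideanSpace ℝ (Fin p)) : Finset (Fin p) :=
  Finset.univ.filter fun j => β j ≠ 0

/-- `D̂(S)`: the covariance of the residuals of `X_{S* \ S}` after regression on `X_S`. -/
def residualCov {n p : ℕ} (X : Matrix (Fin n) (Fin p) ℝ) (Sstar S : Finset (Fin p)) :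
    Matrix ↥(Sstar \ S) ↥(Sstar \ S) ℝ :=
  block (sampleCov X) (Sstar \ S) (Sstar \ S) -
    block (sampleCov X) (Sstar \ S) S * (block (sampleCov X) S S)⁻¹ *
      block (sampleCov X) S (Sstar \ S)

/-- The quadratic form `β*_{S* \ S}ᵀ D̂(S) β*_{S* \ S}`. -/
def margin {n p : ℕ} (X : Matrix (Fin n) (Fin p) ℝ) (β : EuclideanSpace ℝ (Fin p))
    (S : Finset (Fin p)) : ℝ :=
  let b : ↥(trueSupport β \ S) → ℝ := fun j => β j
  b ⬝ᵥ (residualCov X (trueSupport β) S).mulVec b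

/-- The supports of size `s` that make exactly `t` mistakes. -/
def mistakes {p : ℕ} (s : ℕ) (β : EuclideanSpace ℝ (Fin p)) (t : ℕ) : Set (Finset (Fin p)) :=
  {S | S.card = s ∧ (S \ trueSupport β).card = t}

/-- The identifiability margin: the minimum of `margin / |S* \ S|` over all the supports that make
between `1` and `s` mistakes (a finite set, nonempty if `1 ≤ s < p`). -/
def identifiability {n p : ℕ} (s : ℕ) (X : Matrix (Fin n) (Fin p) ℝ)
    (β : EuclideanSpace ℝ (Fin p)) : ℝ :=
  sInf ((fun S => margin X β S / ((trueSupport β \ S).card : ℝ)) ''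
    ⋃ t ∈ Set.Icc 1 s, mistakes s β t)

/-- The response vector `y = X β* + ξ`. -/
def response {n p : ℕ} (X : Matrix (Fin n) (Fin p) ℝ) (β : EuclideanSpace ℝ (Fin p))
    (ξ : Fin n → ℝ) : Fin n → ℝ :=
  fun i => ∑ j, X i j * β j + ξ i

end

end TopR

/-!
Let `P_S` be the orthogonal projection onto the column space of `X_S`, and let `t` be the number of
wrong features in `S`. By the Schur complement formula, the bias `v = (I - P_S) X β` satisfies
`‖v‖² = n · margin` (`norm_bias_sq`), so the hypothesis on the identifiability margin says that
`‖v‖²` is at least `C σ² t log p` and at least `8 Δ s t log p / ε`.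

The score of a wrong support is at least `‖(I - P_S) (X β + ξ)‖²` (`le_score_of_bias`). The score of
the true support `S*` is at most `‖(I - P_{S*}) ξ‖²`: when every column of `X_{S*}` has a moderate
inner product with `ξ`, the sparse Riesz condition puts the least squares coefficients inside the
ball of radius `r` (`score_trueSupport_le`). The difference of the two scores is at least
`‖v‖² + 2 ⟪v, ξ⟫ - ‖P_U ξ‖²`, where `U` is the part of the column space of `X_S` orthogonal to the
common columns of `S` and `S*`. The dimension of `U` is at most `t` rather than `s`
(`finrank_newDirections_le`), which is what a union bound over `p ^ (2 t)` supports can afford.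

Both noise terms are at most `‖v‖² / 4` with probability `1 - 2 p ^ (-8 t)`
(`IsSubgaussianVector.measureReal_bias_le`): the linear term by Chernoff's bound, the quadratic one
by the exponential moment bound `𝔼 exp (‖P_U ξ‖² / (4 σ²)) ≤ 2 ^ (t / 2)`, obtained by comparison
with a Gaussian vector (`IsSubgaussianVector.lintegral_exp_norm_sq_le`). Hence, off an event of
probability at most `4 s / p²` (`IsSubgaussianVector.measureReal_badNoise_le`), every wrong support
loses to `S*` by `‖v‖² / 2 ≥ 4 Δ s log p / ε`. Then `S*` is the first enumerated support, and every
other support has relative weight at most `p ^ (-2 s)`; there are at most `p ^ s` of them, so the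
first draw selects `S*` with probability at least `1 / (1 + p ^ (-s))` (`le_topR_apply`). How the
rejection step is carried out plays no role.
-/

namespace TopR

noncomputable section

/-! ### Least squares and column spaces -/

variable {n p : ℕ}

/-- The `j`-th column of the design, as a vector of the Euclidean space `ℝⁿ`. -/
def col (X : Matrix (Fin n) (Fin p) ℝ) (j : Fin p) : EuclideanSpace ℝ (Fin n) :=
  WithLp.toLp 2 fun i => X i j

/-- The fitted vector `X_S b`. -/
def fit (X : Matrix (Fin n) (Fin p) ℝ) (S : Finset (Fin p)) (b : S → ℝ) :
    EuclideanSpace ℝ (Fin n) :=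
  ∑ j : S, b j • col X j

/-- The column space of `X_S`. -/
def colSpan (X : Matrix (Fin n) (Fin p) ℝ) (S : Finset (Fin p)) :
    Submodule ℝ (EuclideanSpace ℝ (Fin n)) :=
  Submodule.span ℝ (Set.range fun j : S => col X j)

/-- The mean vector `X β`. -/
def signal (X : Matrix (Fin n) (Fin p) ℝ) (β : EuclideanSpace ℝ (Fin p)) :
    EuclideanSpace ℝ (Fin n) :=
  ∑ j, β j • col X j

/-- The part `(I - P_S) X β` of the mean vector that the features in `S` cannot explain. -/
def bias (X : Matrix (Fin n) (Fin p) ℝ) (β : EuclideanSpace ℝ (Fin p)) (S : Finset (Fin p)) :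
    EuclideanSpace ℝ (Fin n) :=
  signal X β - (colSpan X S).starProjection (signal X β)

/-- The part of the column space of `X_S` orthogonal to that of `X_{S ∩ S*}`: the new directions
that the wrong features of `S` contribute. -/
def newDirections (X : Matrix (Fin n) (Fin p) ℝ) (Sstar S : Finset (Fin p)) :
    Submodule ℝ (EuclideanSpace ℝ (Fin n)) :=
  (colSpan X (S ∩ Sstar))ᗮ ⊓ colSpan X S

theorem fit_mem_colSpan (X : Matrix (Fin n) (Fin p) ℝ) (S : Finset (Fin p)) (b : S → ℝ) :
    fit X S b ∈ colSpan X S :=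
  Submodule.sum_mem _ fun j _ => Submodule.smul_mem _ _ (Submodule.subset_span ⟨j, rfl⟩)

theorem exists_fit_eq {X : Matrix (Fin n) (Fin p) ℝ} {S : Finset (Fin p)}
    {x : EuclideanSpace ℝ (Fin n)} (hx : x ∈ colSpan X S) : ∃ b, fit X S b = x :=
  (Submodule.mem_span_range_iff_exists_fun ℝ).1 hx

theorem colSpan_mono (X : Matrix (Fin n) (Fin p) ℝ) {S S' : Finset (Fin p)} (h : S ⊆ S') :
    colSpan X S ≤ colSpan X S' := by
  refine Submodule.span_mono ?_
  rintro _ ⟨j, rfl⟩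
  exact ⟨⟨j, h j.2⟩, rfl⟩

theorem fit_add (X : Matrix (Fin n) (Fin p) ℝ) (S : Finset (Fin p)) (b c : S → ℝ) :
    fit X S (b + c) = fit X S b + fit X S c := by
  simp [fit, add_smul, Finset.sum_add_distrib]

theorem rss_eq (X : Matrix (Fin n) (Fin p) ℝ) (y : EuclideanSpace ℝ (Fin n)) (S : Finset (Fin p))
    (b : EuclideanSpace ℝ S) : rss (X, ⇑y) S b = ‖y - fit X S b‖ ^ 2 := by
  rw [EuclideanSpace.real_norm_sq_eq]
  simp [rss, fit, col, mul_comm]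

theorem response_eq (X : Matrix (Fin n) (Fin p) ℝ) (β : EuclideanSpace ℝ (Fin p))
    (x : EuclideanSpace ℝ (Fin n)) : response X β x = ⇑(signal X β + x) := by
  ext i
  simp [response, signal, col, mul_comm]

theorem score_le {D : Dataset n p} {S : Finset (Fin p)} {r : ℝ} {b : EuclideanSpace ℝ S}
    (hb : ‖b‖ ≤ r) : score r D S ≤ rss D S b := by
  refine csInf_le ⟨0, ?_⟩ ⟨b, ?_, rfl⟩
  · rintro _ ⟨b, -, rfl⟩
    exact Finset.sum_nonneg fun i _ => sq_nonneg _
  · exact pow_le_pow_left₀ (norm_nonneg _) hb 2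

theorem le_score {D : Dataset n p} {S : Finset (Fin p)} {r m : ℝ}
    (h : ∀ b, m ≤ rss D S b) : m ≤ score r D S := by
  refine le_csInf ⟨_, 0, by simp [sq_nonneg], rfl⟩ ?_
  rintro _ ⟨b, -, rfl⟩
  exact h b

theorem sampleCov_apply (X : Matrix (Fin n) (Fin p) ℝ) (i j : Fin p) :
    sampleCov X i j = (n : ℝ)⁻¹ * inner ℝ (col X i) (col X j) := by
  simp [sampleCov, col, Matrix.mul_apply, PiLp.inner_apply, mul_comm]

theorem block_mulVec (X : Matrix (Fin n) (Fin p) ℝ) (S₁ S₂ : Finset (Fin p)) (b : S₂ → ℝ)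
    (i : S₁) : (block (sampleCov X) S₁ S₂).mulVec b i
      = (n : ℝ)⁻¹ * inner ℝ (col X i) (fit X S₂ b) := by
  simp only [Matrix.mulVec, dotProduct, block, Matrix.submatrix_apply, sampleCov_apply, fit,
    inner_sum, inner_smul_right, Finset.mul_sum]
  exact Finset.sum_congr rfl fun _ _ => by ring

theorem dotProduct_block_mulVec (X : Matrix (Fin n) (Fin p) ℝ) (S₁ S₂ : Finset (Fin p))
    (a : S₁ → ℝ) (b : S₂ → ℝ) : a ⬝ᵥ (block (sampleCov X) S₁ S₂).mulVec b
      = (n : ℝ)⁻¹ * inner ℝ (fit X S₁ a) (fit X S₂ b) := by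
  have h : fit X S₁ a = ∑ j : S₁, a j • col X j := rfl
  simp only [dotProduct, block_mulVec]
  rw [h, sum_inner, Finset.mul_sum]
  exact Finset.sum_congr rfl fun _ _ => by rw [inner_smul_left]; simp; ring

theorem block_isHermitian (X : Matrix (Fin n) (Fin p) ℝ) (S : Finset (Fin p)) :
    (block (sampleCov X) S S).IsHermitian := by
  ext i j
  simp [block, sampleCov_apply, real_inner_comm]

/-- The lower half of the sparse Riesz condition, in terms of fitted vectors. -/
theorem SparseRiesz.mul_norm_sq_le {X : Matrix (Fin n) (Fin p) ℝ} {s : ℕ} {κlo κhi : ℝ}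
    (h : SparseRiesz X s κlo κhi) {S : Finset (Fin p)} (hS : S ∈ supports p s)
    (b : EuclideanSpace ℝ S) : κlo * ‖b‖ ^ 2 ≤ (n : ℝ)⁻¹ * ‖fit X S b‖ ^ 2 := by
  have hps : (block (sampleCov X) S S - algebraMap ℝ _ κlo).PosSemidef := by
    rw [Matrix.posSemidef_iff_isHermitian_and_spectrum_nonneg]
    refine ⟨(block_isHermitian X S).sub ?_, ?_⟩
    · rw [Matrix.algebraMap_eq_diagonal]
      exact Matrix.isHermitian_diagonal _
    · rw [← spectrum.sub_singleton_eq]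
      rintro _ ⟨x, hx, _, rfl, rfl⟩
      exact sub_nonneg.2 (h S hS hx).1
  have := hps.dotProduct_mulVec_nonneg b
  rw [Matrix.sub_mulVec, dotProduct_sub, Algebra.algebraMap_eq_smul_one, Matrix.smul_mulVec,
    Matrix.one_mulVec, star_trivial, dotProduct_block_mulVec, real_inner_self_eq_norm_sq] at this
  rw [EuclideanSpace.real_norm_sq_eq b]
  simp only [dotProduct, Pi.smul_apply, smul_eq_mul, Finset.mul_sum] at this ⊢
  rw [sub_nonneg] at this
  exact (Finset.sum_congr rfl fun _ _ => by ring).trans_le this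

theorem SparseRiesz.isUnit_det {X : Matrix (Fin n) (Fin p) ℝ} {s : ℕ} {κlo κhi : ℝ}
    (h : SparseRiesz X s κlo κhi) (hκ : 0 < κlo) {S : Finset (Fin p)} (hS : S ∈ supports p s) :
    IsUnit (block (sampleCov X) S S).det := by
  rw [← Matrix.isUnit_iff_isUnit_det, ← spectrum.zero_notMem_iff ℝ]
  exact fun h0 => hκ.not_ge (h S hS h0).1

theorem SparseRiesz.le {X : Matrix (Fin n) (Fin p) ℝ} {s : ℕ} {κlo κhi : ℝ}
    (h : SparseRiesz X s κlo κhi) {S : Finset (Fin p)} (hS : S ∈ supports p s)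
    (hne : S.Nonempty) : κlo ≤ κhi := by
  have := h S hS ((block_isHermitian X S).eigenvalues_mem_spectrum_real
    ⟨hne.choose, hne.choose_spec⟩)
  exact this.1.trans this.2

theorem signal_eq_add (X : Matrix (Fin n) (Fin p) ℝ) (β : EuclideanSpace ℝ (Fin p))
    (S : Finset (Fin p)) : signal X β = fit X (trueSupport β \ S) (fun j => β j)
      + fit X S (fun j => β j) := by
  have h1 : ∀ S' : Finset (Fin p), fit X S' (fun j => β j) = ∑ j ∈ S', β j • col X j :=
    fun S' => Finset.sum_coe_sort S' fun j => β j • col X j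
  rw [h1, h1, ← Finset.sum_union Finset.sdiff_disjoint, signal]
  refine (Finset.sum_subset (Finset.subset_univ _) fun j _ hj => ?_).symm
  have : β j = 0 := by
    by_contra hne
    exact hj (by simp [trueSupport, hne])
  simp [this]

/-- The Schur complement `D̂(S)` measures the bias that the support `S` causes. -/
theorem norm_bias_sq (X : Matrix (Fin n) (Fin p) ℝ) (β : EuclideanSpace ℝ (Fin p))
    {S : Finset (Fin p)} (hn : n ≠ 0) (hdet : IsUnit (block (sampleCov X) S S).det) :
    ‖bias X β S‖ ^ 2 = n * margin X β S := by
  set b : ↥(trueSupport β \ S) → ℝ := fun j => β j with hb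
  set w := fit X (trueSupport β \ S) b with hw
  -- the coefficients of the regression of `w` on `X_S`
  set c := (block (sampleCov X) S S)⁻¹.mulVec
    ((block (sampleCov X) S (trueSupport β \ S)).mulVec b) with hc
  have hn' : (n : ℝ) ≠ 0 := Nat.cast_ne_zero.2 hn
  have horth : w - fit X S c ∈ (colSpan X S)ᗮ := by
    have hG : (block (sampleCov X) S S).mulVec c
        = (block (sampleCov X) S (trueSupport β \ S)).mulVec b := by
      rw [hc, Matrix.mulVec_mulVec, Matrix.mul_nonsing_inv _ hdet, Matrix.one_mulVec]
    rw [colSpan, Submodule.mem_orthogonal]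
    intro u hu
    induction hu using Submodule.span_induction with
    | mem x hx =>
      obtain ⟨j, rfl⟩ := hx
      have := congrFun hG j
      rw [block_mulVec, block_mulVec, mul_right_inj' (inv_ne_zero hn')] at this
      rw [inner_sub_right, this, sub_self]
    | zero => simp
    | add x y _ _ hx hy => rw [inner_add_left, hx, hy, add_zero]
    | smul a x _ hx => rw [inner_smul_left, hx, mul_zero]
  have hproj : (colSpan X S).starProjection (signal X β)
      = fit X S c + fit X S (fun j => β j) := by
    refine (Submodule.eq_starProjection_of_mem_orthogonal
      (add_mem (fit_mem_colSpan _ _ _) (fit_mem_colSpan _ _ _)) ?_)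
    rw [signal_eq_add X β S]
    convert! horth using 1
    rw [hw]; abel
  have hbias : bias X β S = w - fit X S c := by
    rw [bias, hproj, signal_eq_add X β S, hw]; abel
  have h0 : inner ℝ (fit X S c) (w - fit X S c) = 0 :=
    (Submodule.mem_orthogonal _ _).1 horth _ (fit_mem_colSpan _ _ _)
  have hm : margin X β S = (n : ℝ)⁻¹ * inner ℝ w w - (n : ℝ)⁻¹ * inner ℝ w (fit X S c) := by
    rw [hw, ← dotProduct_block_mulVec, ← dotProduct_block_mulVec, hc, margin, residualCov,
      Matrix.sub_mulVec, dotProduct_sub]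
    simp only [Matrix.mulVec_mulVec, Matrix.mul_assoc]
    rfl
  rw [hbias, ← real_inner_self_eq_norm_sq, inner_sub_left, h0, inner_sub_right, hm]
  field_simp
  ring

theorem finrank_colSpan_le (X : Matrix (Fin n) (Fin p) ℝ) (S : Finset (Fin p)) :
    Module.finrank ℝ (colSpan X S) ≤ S.card := by
  exact (finrank_range_le_card (R := ℝ) fun j : S => col X j).trans_eq (Fintype.card_coe S)

/-- Each wrong feature contributes at most one new direction. -/
theorem finrank_newDirections_le (X : Matrix (Fin n) (Fin p) ℝ) (Sstar S : Finset (Fin p)) :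
    Module.finrank ℝ (newDirections X Sstar S) ≤ (S \ Sstar).card := by
  have h1 := Submodule.finrank_add_inf_finrank_orthogonal
    (colSpan_mono X (Finset.inter_subset_left : S ∩ Sstar ⊆ S))
  have h2 : colSpan X S ≤ colSpan X (S ∩ Sstar) ⊔ colSpan X (S \ Sstar) := by
    refine Submodule.span_le.2 ?_
    rintro _ ⟨j, rfl⟩
    by_cases hj : (j : Fin p) ∈ Sstar
    · exact Submodule.mem_sup_left (Submodule.subset_span ⟨⟨j, by simp [hj]⟩, rfl⟩)
    · exact Submodule.mem_sup_right (Submodule.subset_span ⟨⟨j, by simp [hj]⟩, rfl⟩)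
  have h3 := (Submodule.finrank_mono h2).trans (Submodule.finrank_add_le_finrank_add_finrank _ _)
  have h4 := finrank_colSpan_le X (S \ Sstar)
  rw [newDirections]
  omega

theorem norm_sq_starProjection_colSpan_le (X : Matrix (Fin n) (Fin p) ℝ)
    (Sstar S : Finset (Fin p)) (x : EuclideanSpace ℝ (Fin n)) :
    ‖(colSpan X S).starProjection x‖ ^ 2 ≤ ‖(colSpan X Sstar).starProjection x‖ ^ 2
      + ‖(newDirections X Sstar S).starProjection x‖ ^ 2 := by
  set K := colSpan X S
  set W := colSpan X (S ∩ Sstar) with hW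
  set U := newDirections X Sstar S with hU
  have hWK : W ≤ K := colSpan_mono X Finset.inter_subset_left
  have hWL : W ≤ colSpan X Sstar := colSpan_mono X Finset.inter_subset_right
  have hUK : U ≤ K := inf_le_right
  have hdiff : K.starProjection x - W.starProjection x ∈ U := by
    refine ⟨?_, sub_mem (K.starProjection_apply_mem x) (hWK (W.starProjection_apply_mem x))⟩
    have := sub_mem (W.sub_starProjection_mem_orthogonal x)
      (Submodule.orthogonal_le hWK (K.sub_starProjection_mem_orthogonal x))
    rwa [sub_sub_sub_cancel_left] at this
  have hsplit : U.starProjection x = K.starProjection x - W.starProjection x := by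
    refine (Submodule.eq_starProjection_of_mem_orthogonal hdiff ?_)
    rw [← sub_add]
    refine add_mem (Submodule.orthogonal_le hUK (K.sub_starProjection_mem_orthogonal x)) ?_
    rw [Submodule.mem_orthogonal]
    intro u hu
    rw [real_inner_comm]
    exact (Submodule.mem_orthogonal _ _).1 hu.1 _ (W.starProjection_apply_mem x)
  have hpyth : ‖K.starProjection x‖ ^ 2
      = ‖W.starProjection x‖ ^ 2 + ‖U.starProjection x‖ ^ 2 := by
    have h0 : inner ℝ (W.starProjection x) (U.starProjection x) = 0 :=
      (Submodule.mem_orthogonal _ _).1 (U.starProjection_apply_mem x).1 _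
        (W.starProjection_apply_mem x)
    have : K.starProjection x = W.starProjection x + U.starProjection x := by rw [hsplit]; abel
    rw [this, norm_add_sq_real, h0]
    ring
  have hmono : ‖W.starProjection x‖ ≤ ‖(colSpan X Sstar).starProjection x‖ := by
    have := W.norm_starProjection_apply_le ((colSpan X Sstar).starProjection x)
    rwa [← ContinuousLinearMap.comp_apply,
      Submodule.starProjection_comp_starProjection_of_le hWL] at this
  rw [hpyth]
  gcongr

/-- The constrained minimum is bounded below without the norm constraint on the coefficients, by
the residual `(I - P_S) (X β + x)` of unconstrained least squares. -/
theorem le_score_of_bias (X : Matrix (Fin n) (Fin p) ℝ) (β : EuclideanSpace ℝ (Fin p))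
    (S : Finset (Fin p)) (r : ℝ) (x : EuclideanSpace ℝ (Fin n)) :
    ‖bias X β S‖ ^ 2 + 2 * inner ℝ (bias X β S) x + ‖x‖ ^ 2
        - ‖(colSpan X S).starProjection x‖ ^ 2 ≤ score r (X, response X β x) S := by
  refine le_score fun b => ?_
  rw [response_eq, rss_eq]
  set K := colSpan X S with hK
  set f := fit X S b
  have hv : bias X β S ∈ Kᗮ := K.sub_starProjection_mem_orthogonal _
  have hx := K.sub_starProjection_mem_orthogonal x
  have hz : K.starProjection (signal X β) + K.starProjection x - f ∈ K :=
    sub_mem (add_mem (K.starProjection_apply_mem _) (K.starProjection_apply_mem _))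
      (fit_mem_colSpan _ _ _)
  have hdec : signal X β + x - f = (bias X β S + (x - K.starProjection x))
      + (K.starProjection (signal X β) + K.starProjection x - f) := by
    rw [bias]; abel
  have h1 : inner ℝ (bias X β S + (x - K.starProjection x))
      (K.starProjection (signal X β) + K.starProjection x - f) = 0 := by
    rw [real_inner_comm]
    exact (Submodule.mem_orthogonal _ _).1 (add_mem hv hx) _ hz
  have h2 : inner ℝ (bias X β S) (K.starProjection x) = 0 := by
    rw [real_inner_comm]
    exact (Submodule.mem_orthogonal _ _).1 hv _ (K.starProjection_apply_mem x)
  have h3 : ‖x - K.starProjection x‖ ^ 2 = ‖x‖ ^ 2 - ‖K.starProjection x‖ ^ 2 := by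
    have h4 : inner ℝ (K.starProjection x) (x - K.starProjection x) = 0 :=
      (Submodule.mem_orthogonal _ _).1 hx _ (K.starProjection_apply_mem x)
    have h5 : ‖x‖ ^ 2 = ‖K.starProjection x + (x - K.starProjection x)‖ ^ 2 := by
      congr 2; abel
    rw [h5, norm_add_sq_real, h4]
    ring
  rw [hdec, norm_add_sq_real (_ + _), h1, norm_add_sq_real, inner_sub_right, h2, h3]
  nlinarith [sq_nonneg ‖K.starProjection (signal X β) + K.starProjection x - f‖]

/-- On the true support, the least squares coefficients satisfy the norm constraint as soon as the
noise is nearly uncorrelated with each feature, so that the constrained minimum is the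
unconstrained one. -/
theorem score_trueSupport_le {X : Matrix (Fin n) (Fin p) ℝ} {β : EuclideanSpace ℝ (Fin p)}
    {s : ℕ} {κlo κhi r M a : ℝ} {x : EuclideanSpace ℝ (Fin n)} (hn : n ≠ 0) (hs : s ≠ 0)
    (hcard : (trueSupport β).card = s) (hκ : 0 < κlo)
    (hX : SparseRiesz X s κlo κhi) (hM : ‖β‖ ≤ M) (ha : 0 ≤ a)
    (hr : κhi / κlo * M + a / κlo ≤ r)
    (hx : ∀ j ∈ trueSupport β, s * inner ℝ (col X j) x ^ 2 ≤ (n * a) ^ 2) :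
    score r (X, response X β x) (trueSupport β)
      ≤ ‖x‖ ^ 2 - ‖(colSpan X (trueSupport β)).starProjection x‖ ^ 2 := by
  set S := trueSupport β with hS
  set K := colSpan X S with hK
  have hn' : (0 : ℝ) < n := by positivity
  have hSs : S ∈ supports p s := by simp [supports, hcard]
  have hle : κlo ≤ κhi := hX.le hSs (Finset.card_pos.1 (by omega))
  obtain ⟨d₀, hd₀⟩ := exists_fit_eq (K.starProjection_apply_mem x)
  obtain ⟨d, rfl⟩ : ∃ d : EuclideanSpace ℝ S, ⇑d = d₀ := ⟨WithLp.toLp 2 d₀, rfl⟩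
  have hsig : signal X β = fit X S (fun j => β j) := by
    rw [signal_eq_add X β S, hS, Finset.sdiff_self]
    simp [fit]
  -- `κlo n ‖d‖² ≤ ‖X d‖² = ⟪X d, x⟫ ≤ ‖d‖ ‖X_Sᵀ x‖`
  have hd : ‖d‖ ≤ a / κlo := by
    have h1 : κlo * ‖d‖ ^ 2 ≤ (n : ℝ)⁻¹ * ‖fit X S d‖ ^ 2 := hX.mul_norm_sq_le hSs d
    have h2 : ‖fit X S d‖ ^ 2 = inner ℝ (fit X S d) x := by
      have : inner ℝ (K.starProjection x) (x - K.starProjection x) = 0 :=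
        (Submodule.mem_orthogonal _ _).1 (K.sub_starProjection_mem_orthogonal x) _
          (K.starProjection_apply_mem x)
      rw [inner_sub_right, real_inner_self_eq_norm_sq] at this
      rw [hd₀]
      linarith
    have h3 : inner ℝ (fit X S d) x ^ 2 ≤ ‖d‖ ^ 2 * (n * a) ^ 2 := by
      have h4 : inner ℝ (fit X S d) x = ∑ j : S, d j * inner ℝ (col X j) x := by
        simp [fit, sum_inner, inner_smul_left]
      rw [h4, EuclideanSpace.real_norm_sq_eq]
      refine (Finset.sum_mul_sq_le_sq_mul_sq _ _ _).trans ?_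
      gcongr
      calc ∑ j : S, inner ℝ (col X j) x ^ 2 ≤ ∑ j : S, (n * a) ^ 2 / s :=
            Finset.sum_le_sum fun j _ => by
              rw [le_div_iff₀ (by positivity), mul_comm]
              exact hx j j.2
        _ = (n * a) ^ 2 := by
            simp only [Finset.sum_const, Finset.card_univ, Fintype.card_coe, hcard, nsmul_eq_mul]
            field_simp
    have h5 : inner ℝ (fit X S d) x ≤ ‖d‖ * (n * a) := by
      refine abs_le_of_sq_le_sq' ?_ (by positivity) |>.2
      rwa [mul_pow]
    rw [h2, inv_mul_eq_div, le_div_iff₀ hn'] at h1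
    rw [le_div_iff₀ hκ]
    rcases (norm_nonneg d).eq_or_lt with h0 | h0
    · rw [← h0]; simpa using ha
    · have h6 : (n * ‖d‖) * (‖d‖ * κlo) ≤ (n * ‖d‖) * a := by nlinarith
      exact le_of_mul_le_mul_left h6 (by positivity)
  set b : EuclideanSpace ℝ S := WithLp.toLp 2 (fun j : S => β j) with hb
  have hbn : ‖b‖ ≤ M := by
    refine le_trans (pow_le_pow_iff_left₀ (norm_nonneg _) (norm_nonneg _) two_ne_zero |>.1 ?_) hM
    rw [EuclideanSpace.real_norm_sq_eq, EuclideanSpace.real_norm_sq_eq]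
    exact (Finset.sum_coe_sort S fun j => β j ^ 2).trans_le
      (Finset.sum_le_sum_of_subset_of_nonneg (Finset.subset_univ _) fun _ _ _ => sq_nonneg _)
  have hM0 : 0 ≤ M := (norm_nonneg _).trans hM
  have hbd : ‖b + d‖ ≤ r := by
    have : M ≤ κhi / κlo * M := le_mul_of_one_le_left hM0 ((one_le_div hκ).2 hle)
    linarith [norm_add_le b d]
  refine (score_le hbd).trans_eq ?_
  have hx' := Submodule.norm_sq_eq_add_norm_sq_starProjection x K
  rw [response_eq, rss_eq, WithLp.ofLp_add, fit_add, hd₀, hsig]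
  have : fit X S (fun j => β j) + x - (fit X S ⇑b + K.starProjection x)
      = Kᗮ.starProjection x := by
    rw [Submodule.starProjection_orthogonal_val]
    simp only [hb]
    abel
  rw [this, hx']
  ring

/-! ### Sub-Gaussian vectors -/

theorem lintegral_exp_mul_gaussianReal (a : ℝ) :
    ∫⁻ g, ENNReal.ofReal (Real.exp (a * g)) ∂gaussianReal 0 1
      = ENNReal.ofReal (Real.exp (a ^ 2 / 2)) := by
  rw [← ofReal_integral_eq_lintegral_ofReal (integrable_exp_mul_gaussianReal a)
    (ae_of_all _ fun _ => (Real.exp_pos _).le)]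
  have := congrFun (mgf_fun_id_gaussianReal (μ := 0) (v := 1)) a
  rw [mgf] at this
  rw [this]
  simp

theorem lintegral_exp_sq_div_four_gaussianReal :
    ∫⁻ g, ENNReal.ofReal (Real.exp (g ^ 2 / 4)) ∂gaussianReal 0 1
      = ENNReal.ofReal (Real.sqrt 2) := by
  rw [gaussianReal_of_var_ne_zero _ one_ne_zero,
    lintegral_withDensity_eq_lintegral_mul _ (measurable_gaussianPDF 0 1) (by fun_prop)]
  have h : ∀ g : ℝ, (gaussianPDF 0 1 * fun g => ENNReal.ofReal (Real.exp (g ^ 2 / 4))) g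
      = ENNReal.ofReal ((Real.sqrt (2 * Real.pi))⁻¹ * Real.exp (-(1 / 4) * g ^ 2)) := by
    intro g
    rw [Pi.mul_apply, gaussianPDF, ← ENNReal.ofReal_mul (gaussianPDFReal_nonneg _ _ _),
      gaussianPDFReal, mul_assoc, ← Real.exp_add]
    congr 3
    · simp
    · simp; ring
  simp_rw [h]
  rw [← ofReal_integral_eq_lintegral_ofReal
    ((integrable_exp_neg_mul_sq (by norm_num)).const_mul _) (ae_of_all _ fun _ => by positivity),
    integral_const_mul, integral_gaussian]
  congr 1
  rw [← Real.sqrt_inv, ← Real.sqrt_mul (by positivity)]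
  congr 1
  have := Real.pi_pos
  field_simp
  norm_num

theorem lintegral_pi_prod {ι : Type*} [Fintype ι] (ν : Measure ℝ) [IsProbabilityMeasure ν]
    (f : ι → ℝ → ℝ≥0∞) (hf : ∀ i, Measurable (f i)) :
    ∫⁻ g, ∏ i, f i (g i) ∂Measure.pi (fun _ : ι => ν) = ∏ i, ∫⁻ x, f i x ∂ν := by
  have h := lintegral_prod_eq_prod_lintegral_of_indepFun Finset.univ _
    (iIndepFun_pi (μ := fun _ : ι => ν) (X := f) fun i => (hf i).aemeasurable)
    (fun i => (hf i).comp (measurable_pi_apply i))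
  refine h.trans (Finset.prod_congr rfl fun i _ => ?_)
  exact (measurePreserving_eval (fun _ : ι => ν) i).lintegral_comp (hf i)

/-- A random vector all of whose one-dimensional marginals `⟪a, Z⟫` are sub-Gaussian with
parameter `‖a‖² c`. -/
def IsSubgaussianVector {E Ω : Type*} [NormedAddCommGroup E] [InnerProductSpace ℝ E]
    [MeasurableSpace Ω] (Z : Ω → E) (c : ℝ≥0) (μ : Measure Ω) : Prop :=
  ∀ a : E, HasSubgaussianMGF (fun ω => inner ℝ a (Z ω)) (‖a‖₊ ^ 2 * c) μ

theorem isSubgaussianVector_of_iIndepFun {Ω : Type*} [MeasurableSpace Ω] {μ : Measure Ω}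
    {n : ℕ} {ξ : Fin n → Ω → ℝ} {c : ℝ≥0} (hind : iIndepFun ξ μ)
    (hξ : ∀ i, HasSubgaussianMGF (ξ i) c μ) :
    IsSubgaussianVector (fun ω => (WithLp.toLp 2 fun i => ξ i ω : EuclideanSpace ℝ (Fin n)))
      c μ := by
  intro a
  have h := HasSubgaussianMGF.sum_of_iIndepFun (s := Finset.univ)
    (hind.comp (fun i x => a i * x) fun i => measurable_const_mul _)
    fun i _ => (hξ i).const_mul (a i)
  have h' := h.congr (Y := fun ω => inner ℝ a (WithLp.toLp 2 fun i => ξ i ω))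
    (ae_of_all _ fun ω => by simp [PiLp.inner_apply, mul_comm])
  convert! h' using 1
  refine NNReal.eq ((Eq.trans ?_ (NNReal.coe_sum _ _).symm))
  change ‖a‖ ^ 2 * (c : ℝ) = ∑ i, a i ^ 2 * (c : ℝ)
  rw [EuclideanSpace.real_norm_sq_eq, Finset.sum_mul]

section SubgaussianVector

variable {E Ω : Type*} [NormedAddCommGroup E] [InnerProductSpace ℝ E] [MeasurableSpace Ω]
  {Z : Ω → E} {c : ℝ≥0} {μ : Measure Ω}

/-- Squared norm of a projection in terms of its coordinates in an orthonormal basis. -/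
theorem norm_sq_starProjection_eq_sum (U : Submodule ℝ E) [FiniteDimensional ℝ U] (x : E) :
    ‖U.starProjection x‖ ^ 2 = ∑ i, inner ℝ (stdOrthonormalBasis ℝ U i : E) x ^ 2 := by
  rw [U.starProjection_apply, ← Submodule.coe_norm,
    ← (stdOrthonormalBasis ℝ U).sum_sq_norm_inner_right]
  refine Finset.sum_congr rfl fun i _ => ?_
  rw [Real.norm_eq_abs, sq_abs, Submodule.inner_orthogonalProjectionOnto_eq_of_mem_left]

theorem IsSubgaussianVector.lintegral_exp_le (hZ : IsSubgaussianVector Z c μ) (a : E) :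
    ∫⁻ ω, ENNReal.ofReal (Real.exp (inner ℝ a (Z ω))) ∂μ
      ≤ ENNReal.ofReal (Real.exp (‖a‖ ^ 2 * c / 2)) := by
  have h1 := (hZ a).integrable_exp_mul 1
  have h2 := (hZ a).mgf_le 1
  simp only [mgf, one_mul] at h1 h2
  rw [← ofReal_integral_eq_lintegral_ofReal h1 (ae_of_all _ fun _ => (Real.exp_pos _).le)]
  refine ENNReal.ofReal_le_ofReal (h2.trans_eq ?_)
  simp

/-- The exponential moment of the squared norm of a `k`-dimensional projection of a sub-Gaussian
vector is at most the one of a Gaussian vector. The square is linearized by an independent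
standard Gaussian vector `g` of `ℝᵏ`, by `exp (a² / 2) = 𝔼 exp (a g)`; the expectations over the
two vectors are then exchanged. -/
theorem IsSubgaussianVector.lintegral_exp_norm_sq_le [IsProbabilityMeasure μ]
    (hZ : IsSubgaussianVector Z c μ)
    (hc : c ≠ 0) (U : Submodule ℝ E) [FiniteDimensional ℝ U] :
    ∫⁻ ω, ENNReal.ofReal (Real.exp (‖U.starProjection (Z ω)‖ ^ 2 / (4 * c))) ∂μ
      ≤ ENNReal.ofReal (Real.sqrt 2) ^ Module.finrank ℝ U := by
  set k := Module.finrank ℝ U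
  let u := stdOrthonormalBasis ℝ U
  set q : ℝ := (Real.sqrt (2 * c))⁻¹ with hq
  have hc' : (0 : ℝ) < c := by positivity
  have hq2 : q ^ 2 = (2 * c : ℝ)⁻¹ := by rw [hq, inv_pow, Real.sq_sqrt (by positivity)]
  let γ : Measure (Fin k → ℝ) := Measure.pi fun _ => gaussianReal 0 1
  -- the coordinates of the projection
  let z : Fin k → Ω → ℝ := fun i ω => inner ℝ (u i : E) (Z ω)
  have hz : ∀ i, AEMeasurable (z i) μ := fun i => (hZ (u i)).aemeasurable
  have hnorm : ∀ ω, ‖U.starProjection (Z ω)‖ ^ 2 = ∑ i, z i ω ^ 2 :=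
    fun ω => norm_sq_starProjection_eq_sum U (Z ω)
  have h1 : ∀ ω, ENNReal.ofReal (Real.exp (‖U.starProjection (Z ω)‖ ^ 2 / (4 * c)))
      = ∫⁻ g, ∏ i, ENNReal.ofReal (Real.exp (q * z i ω * g i)) ∂γ := by
    intro ω
    rw [lintegral_pi_prod (gaussianReal 0 1)
      (fun i x => ENNReal.ofReal (Real.exp (q * z i ω * x))) fun i => by fun_prop]
    simp_rw [lintegral_exp_mul_gaussianReal]
    rw [← ENNReal.ofReal_prod_of_nonneg fun _ _ => (Real.exp_pos _).le, ← Real.exp_sum, hnorm,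
      Finset.sum_div]
    congr 3
    ext i
    rw [mul_pow, hq2]
    field_simp
    norm_num
  have h2 : ∀ g : Fin k → ℝ, ∫⁻ ω, ∏ i, ENNReal.ofReal (Real.exp (q * z i ω * g i)) ∂μ
      ≤ ∏ i, ENNReal.ofReal (Real.exp (g i ^ 2 / 4)) := by
    intro g
    set a : U := ∑ i, (q * g i) • u i with ha
    have ha2 : ‖(a : E)‖ ^ 2 = ∑ i, (q * g i) ^ 2 := by
      rw [← Submodule.coe_norm, ← u.sum_sq_norm_inner_right]
      refine Finset.sum_congr rfl fun i _ => ?_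
      rw [ha, u.orthonormal.inner_right_fintype, Real.norm_eq_abs, sq_abs]
    have h3 : ∀ ω, ∏ i, ENNReal.ofReal (Real.exp (q * z i ω * g i))
        = ENNReal.ofReal (Real.exp (inner ℝ (a : E) (Z ω))) := by
      intro ω
      rw [← ENNReal.ofReal_prod_of_nonneg fun _ _ => (Real.exp_pos _).le, ← Real.exp_sum]
      congr 2
      rw [ha, Submodule.coe_sum, sum_inner]
      refine Finset.sum_congr rfl fun i _ => ?_
      rw [Submodule.coe_smul, real_inner_smul_left]
      ring
    simp_rw [h3]
    refine (hZ.lintegral_exp_le a).trans_eq ?_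
    rw [← ENNReal.ofReal_prod_of_nonneg fun _ _ => (Real.exp_pos _).le, ← Real.exp_sum, ha2,
      Finset.sum_mul, Finset.sum_div]
    congr 3
    ext i
    rw [mul_pow, hq2]
    field_simp
    ring
  simp_rw [h1]
  rw [lintegral_lintegral_swap]
  · refine (lintegral_mono h2).trans_eq ?_
    rw [lintegral_pi_prod (gaussianReal 0 1)
      (fun _ x => ENNReal.ofReal (Real.exp (x ^ 2 / 4))) fun i => by fun_prop]
    simp [lintegral_exp_sq_div_four_gaussianReal]
  · refine Finset.aemeasurable_fun_prod _ fun i _ => ?_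
    have := (hz i).comp_fst (ν := γ)
    have h4 : Measurable fun x : Ω × (Fin k → ℝ) => x.2 i := by fun_prop
    exact ((this.const_mul q).mul h4.aemeasurable).exp.ennreal_ofReal

theorem IsSubgaussianVector.measureReal_le_norm_sq_le [IsProbabilityMeasure μ]
    (hZ : IsSubgaussianVector Z c μ)
    (hc : c ≠ 0) (U : Submodule ℝ E) [FiniteDimensional ℝ U] (a : ℝ) :
    μ.real {ω | a ≤ ‖U.starProjection (Z ω)‖ ^ 2}
      ≤ Real.sqrt 2 ^ Module.finrank ℝ U * Real.exp (-(a / (4 * c))) := by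
  have hc' : (0 : ℝ) < c := by positivity
  have hmeas : AEMeasurable (fun ω => ‖U.starProjection (Z ω)‖ ^ 2) μ := by
    simp_rw [norm_sq_starProjection_eq_sum U]
    exact Finset.aemeasurable_fun_sum _ fun i _ => (hZ _).aemeasurable.pow_const 2
  have h1 := mul_meas_ge_le_lintegral₀ (hmeas.div_const (4 * c : ℝ)).exp.ennreal_ofReal
    (ENNReal.ofReal (Real.exp (a / (4 * c))))
  have h2 := h1.trans (hZ.lintegral_exp_norm_sq_le hc U)
  have h3 : {ω | ENNReal.ofReal (Real.exp (a / (4 * c)))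
      ≤ ENNReal.ofReal (Real.exp (‖U.starProjection (Z ω)‖ ^ 2 / (4 * c)))}
      = {ω | a ≤ ‖U.starProjection (Z ω)‖ ^ 2} := by
    ext ω
    rw [Set.mem_ofPred_eq, Set.mem_ofPred_eq, ENNReal.ofReal_le_ofReal_iff (Real.exp_pos _).le,
      Real.exp_le_exp, div_le_div_iff_of_pos_right (by positivity)]
  rw [h3, ← ENNReal.ofReal_pow (Real.sqrt_nonneg _), ← ofReal_measureReal,
    ← ENNReal.ofReal_mul (Real.exp_pos _).le, ENNReal.ofReal_le_ofReal_iff (by positivity)] at h2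
  rwa [Real.exp_neg, ← div_eq_mul_inv, le_div_iff₀ (Real.exp_pos _), mul_comm]

/-- The variance proxy is an upper bound `w` for `‖a‖²`, so that `a = 0` is not an exception. -/
theorem IsSubgaussianVector.measureReal_le_inner_le (hZ : IsSubgaussianVector Z c μ)
    {a : E} {w q : ℝ} (ha : ‖a‖ ^ 2 ≤ w) (hq : 0 ≤ q) :
    μ.real {ω | q ≤ inner ℝ a (Z ω)} ≤ Real.exp (-q ^ 2 / (2 * (w * c))) := by
  lift w to ℝ≥0 using (sq_nonneg _).trans ha
  have h : HasSubgaussianMGF (fun ω => inner ℝ a (Z ω)) (w * c) μ :=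
    ⟨(hZ a).integrable_exp_mul, fun t => ((hZ a).mgf_le t).trans <| by
      push_cast
      gcongr⟩
  simpa using h.measure_ge_le hq

end SubgaussianVector

/-! ### Counting supports by their number of mistakes -/

/-- A support of size `s` is determined by its wrong features and by the true features that it
misses. -/
theorem card_filter_card_sdiff_le {p s : ℕ} {Sstar : Finset (Fin p)} (hcard : Sstar.card = s)
    (t : ℕ) : ((supports p s).filter fun S => (S \ Sstar).card = t).card ≤ p ^ (2 * t) := by
  have hmap : ∀ S ∈ (supports p s).filter fun S => (S \ Sstar).card = t,
      (S \ Sstar, Sstar \ S) ∈ (Finset.powersetCard t (Finset.univ : Finset (Fin p))) ×ˢ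
        (Finset.powersetCard t (Finset.univ : Finset (Fin p))) := by
    intro S hS
    simp only [supports, Finset.mem_filter, Finset.mem_powersetCard, Finset.subset_univ,
      true_and] at hS
    have := Finset.card_sdiff_comm (hcard.trans hS.1.symm)
    simp [hS.2, this]
  refine (Finset.card_le_card_of_injOn (fun S => (S \ Sstar, Sstar \ S)) hmap ?_).trans ?_
  · intro S _ S' _ h
    simp only [Prod.mk.injEq] at h
    rw [← Finset.sdiff_union_inter S Sstar, ← Finset.sdiff_union_inter S' Sstar, h.1,
      Finset.inter_comm S, Finset.inter_comm S', ← Finset.sdiff_sdiff_self_left,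
      ← Finset.sdiff_sdiff_self_left, h.2]
  · rw [Finset.card_product, Finset.card_powersetCard, Finset.card_univ, Fintype.card_fin,
      two_mul, pow_add]
    exact Nat.mul_le_mul (Nat.choose_le_pow _ _) (Nat.choose_le_pow _ _)

theorem card_sdiff_pos {p s : ℕ} {Sstar S : Finset (Fin p)} (hcard : Sstar.card = s)
    (hS : S ∈ (supports p s).erase Sstar) : 0 < (S \ Sstar).card := by
  simp only [Finset.mem_erase, supports, Finset.mem_powersetCard] at hS
  rw [Finset.card_pos, Finset.sdiff_nonempty]
  exact fun h => hS.1 (Finset.eq_of_subset_of_card_le h (by omega))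

theorem sum_pow_card_sdiff_le {p s : ℕ} {Sstar : Finset (Fin p)} (hcard : Sstar.card = s)
    (hp : 0 < p) : ∑ S ∈ (supports p s).erase Sstar, (((p : ℝ) ^ 8)⁻¹) ^ (S \ Sstar).card
      ≤ s * ((p : ℝ) ^ 2)⁻¹ := by
  have hp1 : (1 : ℝ) ≤ p := by exact_mod_cast hp
  have hmaps : ∀ S ∈ (supports p s).erase Sstar, (S \ Sstar).card ∈ Finset.Icc 1 s := by
    intro S hS
    refine Finset.mem_Icc.2 ⟨card_sdiff_pos hcard hS, ?_⟩
    simp only [Finset.mem_erase, supports, Finset.mem_powersetCard] at hS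
    exact hS.2.2 ▸ Finset.card_le_card Finset.sdiff_subset
  rw [← Finset.sum_fiberwise_of_maps_to hmaps]
  calc _ ≤ ∑ t ∈ Finset.Icc 1 s, ((p : ℝ) ^ 2)⁻¹ := Finset.sum_le_sum fun t ht => ?_
    _ = s * ((p : ℝ) ^ 2)⁻¹ := by simp
  have ht1 : 1 ≤ t := (Finset.mem_Icc.1 ht).1
  have hle : (((supports p s).erase Sstar).filter fun S => (S \ Sstar).card = t).card
      ≤ p ^ (2 * t) :=
    (Finset.card_le_card (Finset.filter_subset_filter _ (Finset.erase_subset _ _))).trans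
      (card_filter_card_sdiff_le hcard t)
  rw [Finset.sum_congr rfl (g := fun _ => (((p : ℝ) ^ 8)⁻¹) ^ t)
    fun S hS => by rw [(Finset.mem_filter.1 hS).2], Finset.sum_const, nsmul_eq_mul]
  calc _ ≤ (p : ℝ) ^ (2 * t) * (((p : ℝ) ^ 8)⁻¹) ^ t := by
        gcongr
        exact_mod_cast hle
    _ = ((p : ℝ) ^ (6 * t))⁻¹ := by
        have : (p : ℝ) ≠ 0 := by positivity
        rw [inv_pow, ← pow_mul, show 8 * t = 2 * t + 6 * t by ring, pow_add]
        field_simp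
    _ ≤ ((p : ℝ) ^ 2)⁻¹ := by
        gcongr
        omega

/-! ### The score gap -/

/-- The events that make the support with bias `v` and new directions `U` dangerous have
probability at most `2 p ^ (-8 t)`, which is small enough for a union bound over the at most
`p ^ (2 t)` supports that make `t` mistakes. -/
theorem IsSubgaussianVector.measureReal_bias_le {E Ω : Type*} [NormedAddCommGroup E]
    [InnerProductSpace ℝ E] [MeasurableSpace Ω] {Z : Ω → E} {μ : Measure Ω}
    [IsProbabilityMeasure μ] {σ : ℝ≥0} (hZ : IsSubgaussianVector Z (σ ^ 2) μ) (hσ : 0 < σ)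
    (U : Submodule ℝ E) [FiniteDimensional ℝ U] {v : E} {p t : ℕ} (hp : 3 ≤ p) (ht : 0 < t)
    (hU : Module.finrank ℝ U ≤ t) (hv : 1024 * (σ : ℝ) ^ 2 * Real.log p * t ≤ ‖v‖ ^ 2) :
    μ.real ({ω | ‖v‖ ^ 2 / 8 ≤ inner ℝ (-v) (Z ω)} ∪
      {ω | ‖v‖ ^ 2 / 4 ≤ ‖U.starProjection (Z ω)‖ ^ 2}) ≤ 2 * (((p : ℝ) ^ 8)⁻¹) ^ t := by
  have hp0 : (0 : ℝ) < p := by positivity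
  have hσ' : (0 : ℝ) < σ := hσ
  have hlog : 0 < Real.log p := Real.log_pos (by exact_mod_cast (by omega : 1 < p))
  have hv0 : 0 < ‖v‖ ^ 2 := lt_of_lt_of_le (by positivity) hv
  have hexp : ∀ k : ℕ, Real.exp (-(k * (t * Real.log p))) = (((p : ℝ) ^ k)⁻¹) ^ t := by
    intro k
    rw [Real.exp_neg, ← mul_assoc, ← Nat.cast_mul, mul_comm, Real.exp_mul, Real.exp_log hp0,
      Real.rpow_natCast, inv_pow, pow_mul]
  refine (measureReal_union_le _ _).trans ?_
  rw [two_mul]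
  refine add_le_add ?_ ?_
  · refine (hZ.measureReal_le_inner_le (w := ‖v‖ ^ 2) (by rw [norm_neg]) (by positivity)).trans ?_
    rw [← hexp, Real.exp_le_exp]
    push_cast
    rw [neg_div, neg_le_neg_iff, le_div_iff₀ (by positivity)]
    nlinarith
  · refine (hZ.measureReal_le_norm_sq_le (by positivity) U _).trans ?_
    have h1 : Real.sqrt 2 ^ Module.finrank ℝ U ≤ (p : ℝ) ^ t := by
      refine (pow_le_pow_right₀ (Real.one_le_sqrt.2 one_le_two) hU).trans ?_
      gcongr
      refine (Real.sqrt_le_self_iff.2 (Or.inr one_le_two)).trans ?_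
      exact_mod_cast (by omega : 2 ≤ p)
    have h2 : Real.exp (-(‖v‖ ^ 2 / 4 / (4 * ((σ ^ 2 : ℝ≥0) : ℝ)))) ≤ (((p : ℝ) ^ 9)⁻¹) ^ t := by
      rw [← hexp, Real.exp_le_exp, neg_le_neg_iff]
      push_cast
      rw [div_div, le_div_iff₀ (by positivity)]
      nlinarith [mul_pos (mul_pos (pow_pos hσ' 2) hlog) (Nat.cast_pos (α := ℝ).2 ht)]
    calc _ ≤ (p : ℝ) ^ t * (((p : ℝ) ^ 9)⁻¹) ^ t := by gcongr
      _ = (((p : ℝ) ^ 8)⁻¹) ^ t := by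
        rw [← mul_pow]
        congr 1
        field_simp

theorem IsSubgaussianVector.measureReal_col_le {n p : ℕ} {Ω : Type*} [MeasurableSpace Ω]
    {Z : Ω → EuclideanSpace ℝ (Fin n)} {μ : Measure Ω} [IsProbabilityMeasure μ] {σ : ℝ≥0}
    (hZ : IsSubgaussianVector Z (σ ^ 2) μ) (hσ : 0 < σ) {X : Matrix (Fin n) (Fin p) ℝ} {bX : ℝ}
    (hbX : 0 < bX) (hX : ∀ i j, |X i j| ≤ bX) (hn : n ≠ 0) (hp : 0 < p) (j : Fin p) :
    μ.real {ω | 4 * (σ * bX) * Real.sqrt (n * Real.log p) ≤ |inner ℝ (col X j) (Z ω)|}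
      ≤ 2 * ((p : ℝ) ^ 8)⁻¹ := by
  have hp0 : (0 : ℝ) < p := by positivity
  have hn0 : (0 : ℝ) < n := by positivity
  have hσ' : (0 : ℝ) < σ := hσ
  have hlog : 0 ≤ Real.log p := Real.log_natCast_nonneg p
  have hcol : ‖col X j‖ ^ 2 ≤ n * bX ^ 2 := by
    rw [EuclideanSpace.real_norm_sq_eq]
    calc ∑ i, col X j i ^ 2 ≤ ∑ _i : Fin n, bX ^ 2 :=
          Finset.sum_le_sum fun i _ => sq_le_sq' (abs_le.1 (hX i j)).1 (abs_le.1 (hX i j)).2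
      _ = n * bX ^ 2 := by simp
  have hexp : Real.exp (-(4 * (σ * bX) * Real.sqrt (n * Real.log p)) ^ 2
      / (2 * (n * bX ^ 2 * ((σ ^ 2 : ℝ≥0) : ℝ)))) = ((p : ℝ) ^ 8)⁻¹ := by
    have : -(4 * (σ * bX) * Real.sqrt (n * Real.log p)) ^ 2
      / (2 * (n * bX ^ 2 * ((σ ^ 2 : ℝ≥0) : ℝ))) = -(Real.log p * (8 : ℕ)) := by
      rw [mul_pow, Real.sq_sqrt (by positivity)]
      push_cast
      field_simp
      ring
    rw [this, Real.exp_neg, Real.exp_mul, Real.exp_log hp0, Real.rpow_natCast]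
  have hsub : {ω | 4 * (σ * bX) * Real.sqrt (n * Real.log p) ≤ |inner ℝ (col X j) (Z ω)|} ⊆
      {ω | 4 * (σ * bX) * Real.sqrt (n * Real.log p) ≤ inner ℝ (col X j) (Z ω)} ∪
      {ω | 4 * (σ * bX) * Real.sqrt (n * Real.log p) ≤ inner ℝ (-col X j) (Z ω)} := by
    intro ω hω
    simpa [le_abs, inner_neg_left] using hω
  refine (measureReal_mono hsub).trans ((measureReal_union_le _ _).trans ?_)
  rw [two_mul, ← hexp]
  exact add_le_add (hZ.measureReal_le_inner_le hcol (by positivity))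
    (hZ.measureReal_le_inner_le (norm_neg (col X j) ▸ hcol) (by positivity))

/-- The event that the noise is too correlated with a true feature, with the bias of a wrong
support, or with the new directions of a wrong support. -/
def badNoise {n p : ℕ} (s : ℕ) (X : Matrix (Fin n) (Fin p) ℝ) (β : EuclideanSpace ℝ (Fin p))
    (a : ℝ) : Set (EuclideanSpace ℝ (Fin n)) :=
  (⋃ j ∈ trueSupport β, {x | a ≤ |inner ℝ (col X j) x|}) ∪
    ⋃ S ∈ (supports p s).erase (trueSupport β),
      ({x | ‖bias X β S‖ ^ 2 / 8 ≤ inner ℝ (-bias X β S) x} ∪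
        {x | ‖bias X β S‖ ^ 2 / 4
          ≤ ‖(newDirections X (trueSupport β) S).starProjection x‖ ^ 2})

theorem IsSubgaussianVector.measureReal_badNoise_le {n p s : ℕ} {Ω : Type*} [MeasurableSpace Ω]
    {Z : Ω → EuclideanSpace ℝ (Fin n)} {μ : Measure Ω} [IsProbabilityMeasure μ] {σ : ℝ≥0}
    (hZ : IsSubgaussianVector Z (σ ^ 2) μ) (hσ : 0 < σ) {X : Matrix (Fin n) (Fin p) ℝ} {bX : ℝ}
    (hbX : 0 < bX) (hX : ∀ i j, |X i j| ≤ bX) (hn : n ≠ 0) (hp : 3 ≤ p)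
    {β : EuclideanSpace ℝ (Fin p)} (hcard : (trueSupport β).card = s)
    (hbias : ∀ S ∈ (supports p s).erase (trueSupport β),
      1024 * (σ : ℝ) ^ 2 * Real.log p * (S \ trueSupport β).card ≤ ‖bias X β S‖ ^ 2) :
    μ.real (Z ⁻¹' badNoise s X β (4 * (σ * bX) * Real.sqrt (n * Real.log p)))
      ≤ 4 * (s * ((p : ℝ) ^ 2)⁻¹) := by
  have hp1 : (1 : ℝ) ≤ p := by exact_mod_cast (by omega : 1 ≤ p)
  rw [badNoise, Set.preimage_union, Set.preimage_iUnion₂, Set.preimage_iUnion₂]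
  refine (measureReal_union_le _ _).trans ?_
  have h1 : μ.real (⋃ j ∈ trueSupport β, Z ⁻¹'
      {x | 4 * (σ * bX) * Real.sqrt (n * Real.log p) ≤ |inner ℝ (col X j) x|})
      ≤ 2 * (s * ((p : ℝ) ^ 2)⁻¹) := by
    refine (measureReal_biUnion_finset_le _ _).trans ?_
    refine (Finset.sum_le_sum fun j _ =>
      hZ.measureReal_col_le hσ hbX hX hn (by omega) j).trans ?_
    rw [Finset.sum_const, hcard, nsmul_eq_mul, mul_left_comm]
    gcongr
    norm_num
  have h2 : μ.real (⋃ S ∈ (supports p s).erase (trueSupport β), Z ⁻¹'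
      ({x | ‖bias X β S‖ ^ 2 / 8 ≤ inner ℝ (-bias X β S) x} ∪
        {x | ‖bias X β S‖ ^ 2 / 4
          ≤ ‖(newDirections X (trueSupport β) S).starProjection x‖ ^ 2}))
      ≤ 2 * (s * ((p : ℝ) ^ 2)⁻¹) := by
    refine (measureReal_biUnion_finset_le _ _).trans ?_
    refine (Finset.sum_le_sum fun S hS => hZ.measureReal_bias_le hσ _ hp
      (card_sdiff_pos hcard hS) (finrank_newDirections_le X _ S) (hbias S hS)).trans ?_
    rw [← Finset.mul_sum]
    exact mul_le_mul_of_nonneg_left (sum_pow_card_sdiff_le hcard (by omega)) zero_le_two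
  linarith

/-- Off the bad event, half of the bias of a wrong support survives in its score. The noise that
the wrong and the true support absorb in common cancels. -/
theorem score_add_le_of_notMem_badNoise {n p s : ℕ} {X : Matrix (Fin n) (Fin p) ℝ}
    {β : EuclideanSpace ℝ (Fin p)} {κlo κhi r M a : ℝ} {x : EuclideanSpace ℝ (Fin n)}
    (hs : s ≠ 0) (hcard : (trueSupport β).card = s) (hκ : 0 < κlo)
    (hX : SparseRiesz X s κlo κhi) (hM : ‖β‖ ≤ M) (ha : 0 ≤ a) (hp : 3 ≤ p)
    (hsn : (s : ℝ) ≤ n / Real.log p) (hr : κhi / κlo * M + a / κlo ≤ r)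
    (hx : x ∉ badNoise s X β (a * Real.sqrt (n * Real.log p)))
    {S : Finset (Fin p)} (hS : S ∈ (supports p s).erase (trueSupport β)) :
    score r (X, response X β x) (trueSupport β) + ‖bias X β S‖ ^ 2 / 2
      ≤ score r (X, response X β x) S := by
  have hlog : 0 < Real.log p := Real.log_pos (by exact_mod_cast (by omega : 1 < p))
  rw [le_div_iff₀ hlog] at hsn
  have hn : n ≠ 0 := by
    rintro rfl
    have : (0 : ℝ) < s * Real.log p := by positivity
    simp at hsn
    linarith
  simp only [badNoise, Set.mem_union, Set.mem_iUnion, Set.mem_ofPred_eq, exists_prop, not_or,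
    not_exists, not_and, not_le] at hx
  obtain ⟨hcol, hwrong⟩ := hx
  have h1 := le_score_of_bias X β S r x
  have h2 := norm_sq_starProjection_colSpan_le X (trueSupport β) S x
  have h3 : score r (X, response X β x) (trueSupport β)
      ≤ ‖x‖ ^ 2 - ‖(colSpan X (trueSupport β)).starProjection x‖ ^ 2 := by
    refine score_trueSupport_le hn hs hcard hκ hX hM ha hr fun j hj => ?_
    have h4 : inner ℝ (col X j) x ^ 2 ≤ a ^ 2 * (n * Real.log p) := by
      rw [← sq_abs]
      refine (pow_le_pow_left₀ (abs_nonneg _) (hcol j hj).le 2).trans_eq ?_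
      rw [mul_pow, Real.sq_sqrt (by positivity)]
    calc s * inner ℝ (col X j) x ^ 2 ≤ s * (a ^ 2 * (n * Real.log p)) := by gcongr
      _ = n * a ^ 2 * (s * Real.log p) := by ring
      _ ≤ n * a ^ 2 * n := by gcongr
      _ = (n * a) ^ 2 := by ring
  obtain ⟨h5, h6⟩ := hwrong S hS
  rw [inner_neg_left] at h5
  linarith

/-! ### The exponential weights -/

/-- If the best value beats all the others by a gap that shrinks their weights by a factor `q`,
then the first draw selects it with high probability. The weight `q` of the outcome `none` is
counted once for each of the supports that it stands for. -/
theorem le_firstDraw {p s R : ℕ} (hR : 1 < R) (hRN : R ≤ p.choose s) {eps Δ q ρ : ℝ}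
    {v : Fin R → ℝ} (hρ : 0 ≤ ρ) (hq : (p.choose s : ℝ) * q ≤ ρ) (hq0 : 0 ≤ q)
    (hv : ∀ k : Fin R, k ≠ ⟨0, by omega⟩ → Real.exp (-(eps * v k) / (2 * Δ))
      ≤ Real.exp (-(eps * v ⟨0, by omega⟩) / (2 * Δ)) * q) :
    ENNReal.ofReal (1 / (1 + ρ)) ≤ firstDraw p s hR eps Δ v (some ⟨0, by omega⟩) := by
  set w := Real.exp (-(eps * v ⟨0, by omega⟩) / (2 * Δ)) with hw
  have hw0 : 0 < w := Real.exp_pos _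
  have hRN' : (0 : ℝ) ≤ p.choose s - R := sub_nonneg.2 (by exact_mod_cast hRN)
  have hsum : ∑ k : Fin R, Real.exp (-(eps * v k) / (2 * Δ)) ≤ w + R * (w * q) := by
    rw [← Finset.add_sum_erase _ _ (Finset.mem_univ (⟨0, by omega⟩ : Fin R))]
    gcongr
    refine (Finset.sum_le_card_nsmul _ _ _ fun k hk => hv k (Finset.ne_of_mem_erase hk)).trans ?_
    rw [nsmul_eq_mul]
    gcongr
    simp
  have hlast := hv ⟨R - 1, by omega⟩ (by simp [Fin.ext_iff]; omega)
  have htotal : ∑' a, firstWeight p s hR eps Δ v a ≤ ENNReal.ofReal (w * (1 + ρ)) := by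
    rw [tsum_fintype, Fintype.sum_option]
    simp only [firstWeight]
    rw [← ENNReal.ofReal_sum_of_nonneg fun _ _ => (Real.exp_pos _).le,
      ← ENNReal.ofReal_add (by positivity) (by positivity)]
    refine ENNReal.ofReal_le_ofReal ?_
    have h1 := mul_le_mul_of_nonneg_left hlast hRN'
    have h2 := mul_le_mul_of_nonneg_left hq hw0.le
    linarith
  rw [firstDraw, PMF.normalize_apply, firstWeight, ← hw,
    show 1 / (1 + ρ) = w * (w * (1 + ρ))⁻¹ by field_simp, ENNReal.ofReal_mul hw0.le,
    ENNReal.ofReal_inv_of_pos (by positivity)]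
  gcongr

/-- A large score gap makes the true support the best one, and the method then returns it unless
the exponential weights mislead it. -/
theorem le_topR_apply {n p s R : ℕ} (hR : 1 < R) (hRN : R ≤ p.choose s)
    {bX bY r eps : ℝ} (T : ℕ∞) {Shat : Dataset n p → Fin R → Finset (Fin p)} {D : Dataset n p}
    (hbest : IsBestSupports s (score r D) (Shat D)) (hclip : clipData bX bY D = D)
    {Sstar : Finset (Fin p)} (hstar : Sstar ∈ supports p s) (hs : s ≠ 0) (hp : 3 ≤ p)
    (heps : 0 < eps) (hΔ : 0 < sensitivity bX bY r s)
    (hgap : ∀ S ∈ (supports p s).erase Sstar, score r D Sstar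
      + 4 * sensitivity bX bY r s * s * Real.log p / eps ≤ score r D S) :
    ENNReal.ofReal (1 / (1 + ((p : ℝ) ^ s)⁻¹))
      ≤ topR s hR hRN bX bY r eps T Shat D Sstar := by
  have hp0 : (0 : ℝ) < p := by positivity
  have hlog : 0 < Real.log p := Real.log_pos (by exact_mod_cast (by omega : 1 < p))
  set Δ := sensitivity bX bY r s with hΔdef
  have hfirst : Shat D ⟨0, by omega⟩ = Sstar := by
    by_contra hne
    obtain ⟨⟨hmem, -⟩, hmin⟩ := hbest ⟨0, by omega⟩
    have h1 := hmin Sstar hstar fun i hi => absurd hi (by simp [Fin.lt_def])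
    have h2 := hgap _ (Finset.mem_erase.2 ⟨hne, hmem⟩)
    have h3 : 0 < 4 * Δ * s * Real.log p / eps := by positivity
    linarith
  have hfd : ENNReal.ofReal (1 / (1 + ((p : ℝ) ^ s)⁻¹))
      ≤ firstDraw p s hR eps Δ (fun k => score r D (Shat D k)) (some ⟨0, by omega⟩) := by
    refine le_firstDraw hR hRN (q := ((p : ℝ) ^ s)⁻¹ * ((p : ℝ) ^ s)⁻¹) (by positivity) ?_
      (by positivity) fun k hk => ?_
    · have : (p.choose s : ℝ) ≤ (p : ℝ) ^ s := by exact_mod_cast Nat.choose_le_pow p s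
      rw [← mul_assoc]
      refine mul_le_of_le_one_left (by positivity) ?_
      rw [← div_eq_mul_inv]
      exact div_le_one_of_le₀ this (by positivity)
    · have hk0 : (⟨0, by omega⟩ : Fin R) < k := by
        rw [Fin.lt_def]
        rw [Ne, Fin.ext_iff] at hk
        exact Nat.pos_of_ne_zero hk
      have hkm := (hbest k).1
      have h1 := hgap (Shat D k) (Finset.mem_erase.2 ⟨hfirst ▸ hkm.2 _ hk0, hkm.1⟩)
      have hq : ((p : ℝ) ^ s)⁻¹ * ((p : ℝ) ^ s)⁻¹ = Real.exp (-(2 * (s * Real.log p))) := by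
        rw [Real.exp_neg, mul_comm (s : ℝ), two_mul, Real.exp_add, Real.exp_mul,
          Real.exp_log hp0, Real.rpow_natCast, mul_inv]
      rw [hfirst, hq, ← Real.exp_add, Real.exp_le_exp]
      have h2 := mul_le_mul_of_nonneg_left h1 heps.le
      rw [mul_add, mul_div_cancel₀ _ heps.ne'] at h2
      rw [div_le_iff₀ (by positivity), add_mul, div_mul_cancel₀ _ (by positivity)]
      linarith
  rw [topR]
  simp only [hclip]
  rw [PMF.bind_apply]
  refine le_trans ?_ (ENNReal.le_tsum (some ⟨0, by omega⟩))
  simpa [hfirst] using hfd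

/-! ### Clipping, the identifiability margin and the conclusion -/

theorem clip_eq_self {c a : ℝ} (h : |a| ≤ c) : clip c a = a := by
  rw [clip, min_eq_right (abs_le.1 h).2, max_eq_right (abs_le.1 h).1]

theorem clipData_eq_self {n p : ℕ} {bX bY : ℝ} {D : Dataset n p} (hX : ∀ i j, |D.1 i j| ≤ bX)
    (hy : ∀ i, |D.2 i| ≤ bY) : clipData bX bY D = D := by
  refine Prod.ext ?_ ?_
  · ext i j
    exact clip_eq_self (hX i j)
  · ext i
    exact clip_eq_self (hy i)

theorem identifiability_mul_le_margin {n p s : ℕ} (X : Matrix (Fin n) (Fin p) ℝ)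
    {β : EuclideanSpace ℝ (Fin p)} (hcard : (trueSupport β).card = s) {S : Finset (Fin p)}
    (hS : S ∈ (supports p s).erase (trueSupport β)) :
    identifiability s X β * (S \ trueSupport β).card ≤ margin X β S := by
  have hpos := card_sdiff_pos hcard hS
  simp only [Finset.mem_erase, supports, Finset.mem_powersetCard] at hS
  have hcomm := Finset.card_sdiff_comm (hcard.trans hS.2.2.symm)
  rw [← le_div_iff₀ (by exact_mod_cast hpos), ← hcomm]
  refine csInf_le (Set.toFinite _).bddBelow ⟨S, ?_, rfl⟩
  simp only [Set.mem_iUnion]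
  exact ⟨_, ⟨hpos, hS.2.2 ▸ Finset.card_le_card Finset.sdiff_subset⟩, hS.2.2, rfl⟩

/-- A lower bound off an event of small measure bounds the integral; neither the integrand nor the
event need be measurable. -/
theorem mul_one_sub_le_lintegral {Ω : Type*} [MeasurableSpace Ω] {μ : Measure Ω}
    [IsProbabilityMeasure μ] {f : Ω → ℝ≥0∞} {B : Set Ω} {c : ℝ≥0∞}
    (h : ∀ᵐ ω ∂μ, ω ∉ B → c ≤ f ω) : c * (1 - μ B) ≤ ∫⁻ ω, f ω ∂μ := by
  have hm := measurableSet_toMeasurable μ B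
  calc c * (1 - μ B) = ∫⁻ ω, (toMeasurable μ B)ᶜ.indicator (fun _ => c) ω ∂μ := by
        rw [lintegral_indicator_const hm.compl, prob_compl_eq_one_sub hm, measure_toMeasurable]
    _ ≤ ∫⁻ ω, f ω ∂μ := by
        refine lintegral_mono_ae ?_
        filter_upwards [h] with ω hω
        by_cases hB : ω ∈ (toMeasurable μ B)ᶜ
        · rw [Set.indicator_of_mem hB]
          exact hω fun h => hB (subset_toMeasurable μ B h)
        · simp [Set.indicator_of_notMem hB]

end

end TopR

theorem theorem3 :
    ∃ C : ℝ, 0 < C ∧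
      ∀ (n p s R : ℕ) (T : ℕ∞) (X : Matrix (Fin n) (Fin p) ℝ) (β : EuclideanSpace ℝ (Fin p))
        (Ω : Type*) [MeasurableSpace Ω] (μ : Measure Ω) [IsProbabilityMeasure μ]
        (ξ : Fin n → Ω → ℝ) (σ : ℝ≥0) (bX bY M κlo κhi r eps : ℝ)
        (Shat : TopR.Dataset n p → Fin R → Finset (Fin p))
        -- algorithm parameters, and the oracle for the `R` best supports
        (hR : 1 < R) (hRN : R ≤ p.choose s), 1 ≤ T → 0 < eps →
        (∀ D, TopR.IsBestSupports s (TopR.score r D) (Shat D)) →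
        -- i.i.d. zero-mean sub-Gaussian noise, and an `s`-sparse coefficient vector
        iIndepFun ξ μ → (∀ i j, IdentDistrib (ξ i) (ξ j) μ μ) → (∀ i, ∫ ω, ξ i ω ∂μ = 0) →
        0 < σ → (∀ i, HasSubgaussianMGF (ξ i) (σ ^ 2) μ) →
        (TopR.trueSupport β).card = s →
        -- bounded data
        0 < bX → 0 < bY → (∀ i j, |X i j| ≤ bX) →
        (∀ᵐ ω ∂μ, ∀ i, |TopR.response X β (fun i => ξ i ω) i| ≤ bY) →
        -- bounded coefficients
        0 < M → ‖β‖ ≤ M →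
        -- sparse Riesz condition
        0 < κlo → 0 < κhi → TopR.SparseRiesz X s κlo κhi →
        -- sparsity level
        (s : ℝ) ≤ n / Real.log p → 3 ≤ p →
        -- radius of the constraint, and identifiability margin
        κhi / κlo * M + 4 * (σ * bX / κlo) ≤ r →
        max (C * (σ : ℝ) ^ 2) (8 * TopR.sensitivity bX bY r s / eps * s) * (Real.log p / n) ≤
          TopR.identifiability s X β →
        ENNReal.ofReal ((1 - 10 * s * ((p : ℝ) ^ 2)⁻¹) / (1 + ((p : ℝ) ^ s)⁻¹)) ≤
          ∫⁻ ω, TopR.topR s hR hRN bX bY r eps T Shat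
            (X, TopR.response X β fun i => ξ i ω) (TopR.trueSupport β) ∂μ := by
  refine ⟨1024, by norm_num, ?_⟩
  intro n p s R T X β Ω _ μ _ ξ σ bX bY M κlo κhi r eps Shat hR hRN _ heps hbest hind _ _ hσ
    hξ hcard hbX hbY hX hy _ hM hκ _ hRiesz hsn hp hr hident
  have hlog : 0 < Real.log p := Real.log_pos (by exact_mod_cast (by omega : 1 < p))
  have hs : s ≠ 0 := by
    rintro rfl
    rw [Nat.choose_zero_right] at hRN
    omega
  have hn : n ≠ 0 := by
    rintro rfl
    exact hs (by simpa using hsn)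
  have hn0 : (0 : ℝ) < n := by positivity
  have hσ' : (0 : ℝ) < σ := hσ
  have hΔ : 0 < TopR.sensitivity bX bY r s := by
    rw [TopR.sensitivity]
    positivity
  have hstar : TopR.trueSupport β ∈ TopR.supports p s := by simp [TopR.supports, hcard]
  -- each of the two bounds on the identifiability margin is a lower bound on the bias
  have hbias : ∀ q : ℝ, 0 ≤ q →
      q ≤ max (1024 * (σ : ℝ) ^ 2) (8 * TopR.sensitivity bX bY r s / eps * s) →
      ∀ S ∈ (TopR.supports p s).erase (TopR.trueSupport β),
        q * Real.log p * (S \ TopR.trueSupport β).card ≤ ‖TopR.bias X β S‖ ^ 2 := by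
    intro q _ hq S hS
    have h1 := TopR.identifiability_mul_le_margin X hcard hS
    rw [TopR.norm_bias_sq X β hn (hRiesz.isUnit_det hκ (Finset.mem_of_mem_erase hS))]
    have h2 : q * (Real.log p / n) ≤ TopR.identifiability s X β :=
      (mul_le_mul_of_nonneg_right hq (by positivity)).trans hident
    calc q * Real.log p * (S \ TopR.trueSupport β).card
        = n * (q * (Real.log p / n) * (S \ TopR.trueSupport β).card) := by field_simp
      _ ≤ n * (TopR.identifiability s X β * (S \ TopR.trueSupport β).card) := by gcongr
      _ ≤ n * TopR.margin X β S := by gcongr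
  have hZ := TopR.isSubgaussianVector_of_iIndepFun hind hξ
  set Z : Ω → EuclideanSpace ℝ (Fin n) := fun ω => WithLp.toLp 2 fun i => ξ i ω with hZdef
  set B : Set Ω := Z ⁻¹' TopR.badNoise s X β (4 * (σ * bX) * Real.sqrt (n * Real.log p)) with hB
  have hBle : μ.real B ≤ 4 * (s * ((p : ℝ) ^ 2)⁻¹) :=
    hZ.measureReal_badNoise_le hσ hbX hX hn hp hcard
      (hbias _ (by positivity) (le_max_left _ _))
  refine le_trans ?_ (TopR.mul_one_sub_le_lintegral (B := B)
    (c := ENNReal.ofReal (1 / (1 + ((p : ℝ) ^ s)⁻¹))) ?_)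
  · rw [← ofReal_measureReal (s := B), ← ENNReal.ofReal_one,
      ← ENNReal.ofReal_sub _ measureReal_nonneg, ← ENNReal.ofReal_mul (by positivity)]
    refine ENNReal.ofReal_le_ofReal ?_
    rw [div_mul_eq_mul_div, one_mul]
    have : 0 ≤ s * ((p : ℝ) ^ 2)⁻¹ := by positivity
    gcongr
    linarith
  · filter_upwards [hy] with ω hω hωB
    refine TopR.le_topR_apply hR hRN T (hbest _) (TopR.clipData_eq_self hX hω) hstar hs hp heps
      hΔ fun S hS => ?_
    have h1 := TopR.score_add_le_of_notMem_badNoise (a := 4 * (σ * bX)) (r := r) hs hcard hκ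
      hRiesz hM (by positivity) hp hsn (by rwa [mul_div_assoc]) hωB hS
    have h2 := hbias _ (by positivity) (le_max_right _ _) S hS
    have h3 : (1 : ℝ) ≤ (S \ TopR.trueSupport β).card := by
      exact_mod_cast TopR.card_sdiff_pos hcard hS
    have h4 : 4 * TopR.sensitivity bX bY r s * s * Real.log p / eps * 2
        ≤ ‖TopR.bias X β S‖ ^ 2 := by
      refine le_trans (le_of_eq ?_) ((le_mul_of_one_le_right (by positivity) h3).trans h2)
      ring
    refine le_trans ?_ h1
    linarith
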